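/- Let $f,g:\mathbb{R}^2\to\mathbb{R}$ be continuously differentiable, and let $\psi:\mathbb{R}\to\mathbb{R}^2$ be a periodic solution, with minimum period $p>0$, of the kinetic system $$\dot u=f(u,v),\qquad \dot v=g(u,v).$$ Suppose that the Floquet multipliers of the linearization of this system about $\psi$ (the eigenvalues of its monodromy matrix over one period $p$, counted with algebraic multiplicity) are $1$ and $\tilde\gamma$, with $0<\tilde\gamma<1$ (so $\psi$ is a stable limit cycle). Let $n\ge 2$ and consider the $n$-patch model $$\dot u_j=\delta\sum_{i=1}^n\bigl(d_{11}(u_i-u_j)+d_{12}(v_i-v_j)\bigr)+f(u_j,v_j),$$ $$\dot v_j=\delta\sum_{i=1}^n\bigl(d_{21}(u_i-u_j)+d_{22}(v_i-v_j)\bigr)+g(u_j,v_j),\qquad j=1,\dots,n,$$ with identical diffusion rates, $d_{11}=d_{22}=d_0>0$ and $d_{12}=d_{21}=0$. Then there is $\delta_0>0$ such that for every $\delta\in(0,\delta_0)$ the synchronous function $(\psi,\dots,\psi)$ is a periodic solution of the patch model with minimum period $p$, and it is stable: it is Lyapunov stable (for every $\varepsilon>0$ there is $\eta>0$ such that, from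 every initial value at distance less than $\eta$ from $(\psi(0),\dots,\psi(0))$, a solution exists on $[0,\infty)$, and every such solution stays within distance less than $\varepsilon$ of $(\psi(t),\dots,\psi(t))$ for all $t\ge 0$). Moreover, among the $2n$ Floquet multipliers of the linearization of the patch model about $(\psi,\dots,\psi)$, counted with algebraic multiplicity, exactly one equals $1$ and all others have modulus less than $1$. -/

import Mathlib

namespace PatchModel

/-- `x` is a solution on `ℝ` of the autonomous system `x' = F(x)` that is periodic with minimum
period `p > 0` (in particular `x` is not constant). -/
structure IsPeriodicSolution {ι : Type*} [Fintype ι] (F : (ι → ℝ) → (ι → ℝ)) (x : ℝ → ι → ℝ)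
    (p : ℝ) : Prop where
  isSolution : IsIntegralCurve x (fun _ => F)
  period_pos : 0 < p
  periodic : Function.Periodic x p
  minimal : ∀ q : ℝ, 0 < q → q < p → ¬ Function.Periodic x q

/-- Lyapunov stability of the solution `x` of `x' = F(x)`: for every `ε > 0` there is `η > 0` such
that, for every initial value `y₀` with `|y₀ - x(0)| < η`, there is a solution on `[0, ∞)` starting
at `y₀`, and every such solution satisfies `|y(t) - x(t)| < ε` for all `t ≥ 0`. -/
def IsLyapunovStable {ι : Type*} [Fintype ι] (F : (ι → ℝ) → (ι → ℝ)) (x : ℝ → ι → ℝ) : Prop :=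
  ∀ ε > 0, ∃ η > 0, ∀ y₀ : ι → ℝ, dist y₀ (x 0) < η →
    (∃ y : ℝ → ι → ℝ, y 0 = y₀ ∧ IsIntegralCurveOn y (fun _ => F) (Set.Ici 0)) ∧
    ∀ y : ℝ → ι → ℝ, y 0 = y₀ → IsIntegralCurveOn y (fun _ => F) (Set.Ici 0) →
      ∀ t ≥ 0, dist (y t) (x t) < ε

/-- The Jacobian matrix `(∂F_i / ∂x_j)` of the vector field `F` at `x`. -/
noncomputable def jacobian {ι : Type*} [Fintype ι] [DecidableEq ι] (F : (ι → ℝ) → (ι → ℝ))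
    (x : ι → ℝ) : Matrix ι ι ℝ :=
  Matrix.of fun i j => fderiv ℝ F x (Pi.single j 1) i

/-- `Φ` is the principal fundamental matrix solution of the linear system `Y' = A(t) Y`:
`Φ' = A(t) Φ` (entry by entry) and `Φ(0) = I`. -/
def IsPrincipalFundamentalMatrix {ι : Type*} [Fintype ι] [DecidableEq ι] (A : ℝ → Matrix ι ι ℝ)
    (Φ : ℝ → Matrix ι ι ℝ) : Prop :=
  Φ 0 = 1 ∧ ∀ (t : ℝ) (i j : ι), HasDerivAt (fun s => Φ s i j) ((A t * Φ t) i j) t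

/-- The Floquet multipliers of the linearization `Y' = DF(x(t)) Y` about a `p`-periodic solution
`x` of `x' = F(x)`, i.e. the complex eigenvalues of the monodromy matrix `Φ(p)`, are the elements
of the multiset `m`, counted with algebraic multiplicity. -/
def HasFloquetMultipliers {ι : Type*} [Fintype ι] [DecidableEq ι] (F : (ι → ℝ) → (ι → ℝ))
    (x : ℝ → ι → ℝ) (p : ℝ) (m : Multiset ℂ) : Prop :=
  ∃ Φ : ℝ → Matrix ι ι ℝ, IsPrincipalFundamentalMatrix (fun t => jacobian F (x t)) Φ ∧
    ((Φ p).map Complex.ofReal).charpoly.roots = m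

/-- The planar kinetic vector field `(u, v) ↦ (f(u, v), g(u, v))`, with `u = x 0`, `v = x 1`. -/
def kineticField (f g : ℝ → ℝ → ℝ) (x : Fin 2 → ℝ) : Fin 2 → ℝ :=
  ![f (x 0) (x 1), g (x 0) (x 1)]

/-- The vector field of the `n`-patch model with coupling strength `δ` and diffusion matrix
`D = (d_kl)`; the state `U` has coordinates `u_j = U (j, 0)` and `v_j = U (j, 1)`. -/
def patchField (n : ℕ) (δ : ℝ) (D : Matrix (Fin 2) (Fin 2) ℝ) (f g : ℝ → ℝ → ℝ)
    (U : Fin n × Fin 2 → ℝ) : Fin n × Fin 2 → ℝ := fun jk =>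
  ![δ * ∑ i : Fin n, (D 0 0 * (U (i, 0) - U (jk.1, 0)) + D 0 1 * (U (i, 1) - U (jk.1, 1)))
      + f (U (jk.1, 0)) (U (jk.1, 1)),
    δ * ∑ i : Fin n, (D 1 0 * (U (i, 0) - U (jk.1, 0)) + D 1 1 * (U (i, 1) - U (jk.1, 1)))
      + g (U (jk.1, 0)) (U (jk.1, 1))] jk.2

/-- The synchronous function `(ψ, …, ψ)` with `n` copies of `ψ`. -/
def synchronous (n : ℕ) (ψ : ℝ → Fin 2 → ℝ) : ℝ → Fin n × Fin 2 → ℝ :=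
  fun t jk => ψ t jk.2

end PatchModel

open Set Filter Topology Metric
open scoped NNReal Kronecker

/-! For `D = d₀ • 1` the coupling is `-κ` times the projection onto differences between patches, `κ
= δ * d₀ * n`. It commutes with the copies of the kinetic linearization, so the linearized patch
model has fundamental matrix `averagingScale n (exp (-κ t)) ⊗ₖ Φ t`
(`isPrincipalFundamentalMatrix_patch`). With `c = exp (-κ p) < 1` its multipliers are `1, γ` once
and `c, c γ` each `n - 1` times.

Stability is obtained without a Poincaré section (`isLyapunovStable_of_tendsto_monodromy_pow`). The
time-`p` map fixes every point of the orbit, and its derivative at `ψ 0` is the monodromy matrix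
(`hasStrictFDerivAt_flow`), whose powers converge to a projection onto the flow direction. Hence
some iterate halves the displacement from the orbit and moves points by a multiple of that
displacement; the moves sum geometrically, so iterates stay near `ψ 0`
(`HasStrictFDerivAt.exists_iterate_stable`). Grönwall's inequality covers the times in between. -/

/-! ### Global flows and truncation of vector fields -/

/-- A bounded, globally Lipschitz vector field is complete. -/
theorem LipschitzWith.exists_isIntegralCurve {E : Type*} [NormedAddCommGroup E] [NormedSpace ℝ E]
    [CompleteSpace E] {G : E → E} {K L : ℝ≥0} (hG : LipschitzWith K G) (hL : ∀ x, ‖G x‖ ≤ L)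
    (y₀ : E) : ∃ y : ℝ → E, y 0 = y₀ ∧ IsIntegralCurve y (fun _ => G) := by
  have key : ∀ n : ℕ, ∃ y : ℝ → E, y 0 = y₀ ∧
      ∀ t ∈ Ioo (-(n + 1 : ℝ)) (n + 1), HasDerivAt y (G (y t)) t := by
    intro n
    have h0 : (0 : ℝ) ∈ Icc (-(n + 1 : ℝ)) (n + 1) := ⟨by linarith, by positivity⟩
    -- The global bound `L` lets the Picard ball have radius `L * (n + 1)`, so the time interval can
    -- be as long as desired.
    have hpl : IsPicardLindelof (fun _ : ℝ => G) (⟨0, h0⟩ : Icc (-(n + 1 : ℝ)) (n + 1)) y₀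
        (L * (n + 1)) 0 L K :=
      IsPicardLindelof.of_time_independent (fun x _ => hL x) hG.lipschitzOnWith (by simp)
    obtain ⟨y, hy0, hy⟩ := hpl.exists_eq_forall_mem_Icc_hasDerivWithinAt₀
    exact ⟨y, hy0, fun t ht => (hy t (Ioo_subset_Icc_self ht)).hasDerivAt (Icc_mem_nhds ht.1 ht.2)⟩
  choose α hα0 hα using key
  have agree : ∀ m n : ℕ, m ≤ n → EqOn (α m) (α n) (Ioo (-(m + 1 : ℝ)) (m + 1)) := by
    intro m n hmn
    have hmn' : (m : ℝ) ≤ n := by exact_mod_cast hmn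
    refine ODE_solution_unique_of_mem_Ioo (v := fun _ => G) (s := fun _ => univ) (K := K) (t₀ := 0)
      (fun _ _ => hG.lipschitzOnWith) ⟨by linarith, by positivity⟩
      (fun t ht => ⟨hα m t ht, trivial⟩)
      (fun t ht => ⟨hα n t ⟨by linarith [ht.1], by linarith [ht.2]⟩, trivial⟩) ?_
    rw [hα0, hα0]
  refine ⟨fun t => α ⌈|t|⌉₊ t, by simp [hα0], fun t => ?_⟩
  have hN := Nat.le_ceil |t|
  set N := ⌈|t|⌉₊ with hNdef
  -- The index is `N + 1` because `⌈|s|⌉₊` can exceed `N` for `s` near `t`.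
  have hmem : t ∈ Ioo (-((N + 1 : ℕ) + 1 : ℝ)) ((N + 1 : ℕ) + 1) := by
    push_cast
    exact ⟨by linarith [neg_abs_le t], by linarith [le_abs_self t]⟩
  have hev : (fun s => α ⌈|s|⌉₊ s) =ᶠ[𝓝 t] α (N + 1) := by
    have : ∀ᶠ s : ℝ in 𝓝 t, |s| < (N : ℝ) + 1 :=
      continuous_abs.continuousAt.eventually (Iio_mem_nhds (by linarith))
    filter_upwards [this] with s hs
    have h1 : ⌈|s|⌉₊ ≤ N + 1 := Nat.ceil_le.2 (by push_cast; exact hs.le)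
    have h2 := Nat.le_ceil |s|
    exact agree _ _ h1 ⟨by linarith [neg_abs_le s], by linarith [le_abs_self s]⟩
  have := (hα (N + 1) t hmem).congr_of_eventuallyEq hev
  rwa [← hev.eq_of_nhds] at this

theorem IsIntegralCurve.dist_le_of_lipschitzWith {E : Type*} [NormedAddCommGroup E]
    [NormedSpace ℝ E] {G : E → E} {K : ℝ≥0} (hG : LipschitzWith K G) {y z : ℝ → E}
    (hy : IsIntegralCurve y (fun _ => G)) (hz : IsIntegralCurve z (fun _ => G)) {t T : ℝ}
    (ht : 0 ≤ t) (htT : t ≤ T) : dist (y t) (z t) ≤ dist (y 0) (z 0) * Real.exp (K * T) := by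
  have := dist_le_of_trajectories_ODE (v := fun _ => G) (fun _ => hG) hy.continuous.continuousOn
    (fun s _ => (hy s).hasDerivWithinAt) hz.continuous.continuousOn
    (fun s _ => (hz s).hasDerivWithinAt) le_rfl t (right_mem_Icc.2 ht)
  refine this.trans ?_
  rw [sub_zero]
  gcongr

/-- A `C¹` vector field on `ι → ℝ` agrees on any ball with a bounded Lipschitz one. -/
theorem ContDiff.exists_lipschitzWith_eqOn_closedBall {ι F' : Type*} [Fintype ι]
    [NormedAddCommGroup F'] [NormedSpace ℝ F']
    {F : (ι → ℝ) → F'} (hF : ContDiff ℝ 1 F) {R : ℝ} (hR : 0 ≤ R) :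
    ∃ (G : (ι → ℝ) → F') (K L : ℝ≥0), LipschitzWith K G ∧ (∀ x, ‖G x‖ ≤ L) ∧
      EqOn G F (closedBall 0 R) := by
  -- In the sup norm a ball is a cube, so clamping each coordinate is a 1-Lipschitz retraction onto
  -- it.
  let r : (ι → ℝ) → ι → ℝ := fun x i => max (-R) (min R (x i))
  have hr : LipschitzWith 1 r := by
    refine LipschitzWith.of_dist_le_mul fun x y => ?_
    rw [NNReal.coe_one, one_mul, dist_pi_le_iff dist_nonneg]
    intro i
    refine le_trans ?_ (dist_le_pi_dist x y i)
    simpa using (((LipschitzWith.id (α := ℝ)).const_min R).const_max (-R)).dist_le_mul (x i) (y i)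
  have hrm : ∀ x, r x ∈ closedBall (0 : ι → ℝ) R := by
    intro x
    rw [mem_closedBall_zero_iff, pi_norm_le_iff_of_nonneg hR]
    intro i
    rw [Real.norm_eq_abs, abs_le]
    exact ⟨le_max_left _ _, max_le (by linarith) (min_le_left _ _)⟩
  have hc : IsCompact (closedBall (0 : ι → ℝ) R) := isCompact_closedBall _ _
  obtain ⟨K, hK⟩ :=
    (hF.locallyLipschitz.locallyLipschitzOn (s := closedBall 0 R)).exists_lipschitzOnWith_of_compact
      hc
  obtain ⟨L, hL⟩ := hc.exists_bound_of_continuousOn hF.continuous.continuousOn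
  refine ⟨F ∘ r, K * 1, L.toNNReal, ?_, fun x => (hL _ (hrm x)).trans (Real.le_coe_toNNReal L), ?_⟩
  · rw [← lipschitzOnWith_univ] at hr ⊢
    exact hK.comp hr fun x _ => hrm x
  · intro x hx
    have : r x = x := by
      ext i
      rw [mem_closedBall_zero_iff, pi_norm_le_iff_of_nonneg hR] at hx
      have := abs_le.1 (hx i)
      simp [r, this.1, this.2]
    simp [this]

/-! ### Stability of a curve of fixed points -/

/-- Near a point of a regular curve `c`, projection onto the curve along the kernel of a
functional `q` transverse to it. -/
theorem HasStrictDerivAt.exists_projection_along {E : Type*} [NormedAddCommGroup E]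
    [NormedSpace ℝ E] {c : ℝ → E} {v : E} (hc : HasStrictDerivAt c v 0) (q : E →L[ℝ] ℝ)
    (hq : q v = 1) :
    ∃ σ : E → ℝ, (∃ σ' : E →L[ℝ] ℝ, HasStrictFDerivAt σ σ' (c 0)) ∧ σ (c 0) = 0 ∧
      (∀ᶠ y in 𝓝 (c 0), q (c (σ y)) = q y) ∧ ∀ᶠ s in 𝓝 (0 : ℝ), σ (c s) = s := by
  -- Only the scalar function `q ∘ c` has to be inverted: `σ y` solves `q (c s) = q y` for `s`.
  have hh : HasStrictDerivAt (fun s => q (c s)) 1 0 := by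
    have := q.hasStrictFDerivAt.comp_hasStrictDerivAt (0 : ℝ) hc
    rwa [hq] at this
  have he := hh.hasStrictFDerivAt_equiv one_ne_zero
  refine ⟨fun y => he.localInverse _ _ _ (q y),
    ⟨_, he.to_localInverse.comp (c 0) q.hasStrictFDerivAt⟩, ?_, ?_, ?_⟩
  · exact he.localInverse_apply_image
  · exact q.continuous.continuousAt.eventually he.eventually_right_inverse
  · exact he.eventually_left_inverse

/-- Let `c` be a curve of fixed points of `S`, and suppose that the powers of the strict derivative
of `S` at `c 0` converge to a map that vanishes on a complement of the tangent line of `c`. Then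
`c 0` is stable under the iterates of some power of `S`. -/
theorem HasStrictFDerivAt.exists_iterate_stable {E : Type*} [NormedAddCommGroup E]
    [NormedSpace ℝ E] {S : E → E} {M N : E →L[ℝ] E} {c : ℝ → E} {v : E}
    (hS : HasStrictFDerivAt S M (c 0)) (hc : HasStrictDerivAt c v 0) (hfix : ∀ s, S (c s) = c s)
    (q : E →L[ℝ] ℝ) (hq : q v = 1) (hM : Tendsto (fun k : ℕ => M ^ k) atTop (𝓝 N))
    (hN : ∀ w, q w = 0 → N w = 0) :
    ∃ k : ℕ, 0 < k ∧ ∀ ε > 0, ∃ η > 0, ∀ y, dist y (c 0) < η →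
      ∀ m : ℕ, dist ((S^[k])^[m] y) (c 0) < ε := by
  obtain ⟨σ, ⟨σ', hσ⟩, hσ0, hqσ, hσc⟩ := hc.exists_projection_along q hq
  set x₀ := c 0 with hx₀
  obtain ⟨π', hπ⟩ : ∃ π' : E →L[ℝ] E, HasStrictFDerivAt (fun y => c (σ y)) π' x₀ := by
    have h2 : HasStrictDerivAt c v (σ x₀) := by rwa [hσ0]
    exact ⟨_, h2.hasStrictFDerivAt.comp x₀ hσ⟩
  have hR := (hasStrictFDerivAt_id (𝕜 := ℝ) x₀).sub hπ
  set R : E → E := fun y => y - c (σ y) with hRdef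
  obtain ⟨K, s, hs, hK⟩ := hR.exists_lipschitzOnWith
  replace hK : LipschitzOnWith K R s := hK
  have hπx₀ : c (σ x₀) = x₀ := by rw [hσ0]
  -- `θ` is chosen so that `K * 2θ ≤ 1/2`, which gives the halving, and `2θ + 1 ≤ 2`, which bounds
  -- the displacement.
  have hθ : (0 : ℝ) < 1 / (4 * (K + 1)) := by positivity
  set θ : ℝ := 1 / (4 * (K + 1)) with hθdef
  have hKθ : K * (2 * θ) ≤ 1 / 2 := by
    have : θ * (4 * (K + 1)) = 1 := by rw [hθdef]; field_simp
    nlinarith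
  have hθ4 : θ ≤ 1 / 4 := by
    rw [hθdef]
    apply one_div_le_one_div_of_le (by norm_num)
    nlinarith [K.coe_nonneg]
  obtain ⟨k, hkθ, hk⟩ := (((tendsto_iff_norm_sub_tendsto_zero.1 hM).eventually
    (gt_mem_nhds hθ)).and (eventually_gt_atTop 0)).exists
  refine ⟨k, hk, ?_⟩
  have hT : HasStrictFDerivAt S^[k] (M ^ k) x₀ := hS.iterate (hfix 0) k
  have hTfix : ∀ u, S^[k] (c u) = c u := fun u => Function.IsFixedPt.iterate (hfix u) k
  set T := S^[k] with hTdef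
  obtain ⟨s₂, hs₂, happ⟩ := hT.approximates_deriv_on_nhds (c := ⟨θ, hθ.le⟩) (Or.inr hθ)
  have hπt : Tendsto (fun y => c (σ y)) (𝓝 x₀) (𝓝 x₀) := by
    simpa only [ContinuousAt, hπx₀] using hπ.continuousAt
  have hTt : Tendsto T (𝓝 x₀) (𝓝 x₀) := by
    have := hT.continuousAt
    rwa [ContinuousAt, hTfix 0] at this
  have hσt : Tendsto σ (𝓝 x₀) (𝓝 0) := by
    simpa only [ContinuousAt, hσ0] using hσ.continuousAt
  obtain ⟨ρ, hρ, hball⟩ := Metric.eventually_nhds_iff.1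
    ((hπt.eventually hs₂).and <| (hπt.eventually hs).and <| (hTt.eventually hs).and <|
      (hσt.eventually hσc).and <| hqσ.and <| (eventually_mem_set.2 hs₂).and
        (eventually_mem_set.2 hs))
  -- `T` fixes `c (σ y)`, so `T y - c (σ y)` is nearly `(M ^ k) (R y)`; as `R y` lies in the kernel
  -- of `q`, where `N` vanishes, this is small relative to `R y`. Since `R` vanishes on the curve,
  -- its Lipschitz bound then controls `R (T y)`.
  have step : ∀ y, dist y x₀ < ρ → ‖R (T y)‖ ≤ 1 / 2 * ‖R y‖ ∧ ‖T y - y‖ ≤ 2 * ‖R y‖ := by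
    intro y hy
    obtain ⟨h1, h2, h3, h4, h5, h6, h7⟩ := hball hy
    have hker : q (R y) = 0 := by simp [hRdef, h5]
    have e1 : ‖T y - c (σ y)‖ ≤ 2 * θ * ‖R y‖ := by
      have ha := happ y h6 _ h1
      rw [hTfix] at ha
      have hb : ‖(M ^ k) (R y)‖ ≤ θ * ‖R y‖ := by
        have : (M ^ k) (R y) = (M ^ k - N) (R y) := by simp [hN _ hker]
        rw [this]
        exact (ContinuousLinearMap.le_opNorm _ _).trans (by gcongr)
      calc ‖T y - c (σ y)‖ = ‖(T y - c (σ y) - (M ^ k) (y - c (σ y))) + (M ^ k) (R y)‖ := by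
            rw [hRdef]; simp
        _ ≤ θ * ‖R y‖ + θ * ‖R y‖ := (norm_add_le _ _).trans (add_le_add ha hb)
        _ = _ := by ring
    constructor
    · have hz : R (c (σ y)) = 0 := by simp [hRdef, h4]
      calc ‖R (T y)‖ = ‖R (T y) - R (c (σ y))‖ := by rw [hz, sub_zero]
        _ ≤ K * ‖T y - c (σ y)‖ := hK.norm_sub_le h3 h2
        _ ≤ K * (2 * θ * ‖R y‖) := by gcongr
        _ = K * (2 * θ) * ‖R y‖ := by ring
        _ ≤ _ := by gcongr
    · calc ‖T y - y‖ = ‖(T y - c (σ y)) - R y‖ := by rw [hRdef]; simp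
        _ ≤ 2 * θ * ‖R y‖ + ‖R y‖ := (norm_sub_le _ _).trans (by gcongr)
        _ ≤ _ := by nlinarith [norm_nonneg (R y)]
  intro ε hε
  set ρ' := min ρ ε with hρ'
  have hρ'0 : 0 < ρ' := lt_min hρ hε
  -- The iterates move at most `4 * ‖R y‖ ≤ 4 * K * ‖y - x₀‖` away from `y`.
  refine ⟨ρ' / (4 * K + 1), by positivity, fun y hy => ?_⟩
  have hy' : (4 * K + 1) * ‖y - x₀‖ < ρ' := by
    rw [dist_eq_norm, lt_div_iff₀ (by positivity)] at hy
    linarith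
  have hyρ : dist y x₀ < ρ := by
    rw [dist_eq_norm]
    have := mul_nonneg K.coe_nonneg (norm_nonneg (y - x₀))
    nlinarith [min_le_left ρ ε]
  have hRy : ‖R y‖ ≤ K * ‖y - x₀‖ := by
    have := hK.norm_sub_le (hball hyρ).2.2.2.2.2.2 (mem_of_mem_nhds hs)
    have hz : R x₀ = 0 := by simp [hRdef, hπx₀]
    rwa [hz, sub_zero] at this
  have near : ∀ z, ‖z - y‖ ≤ 4 * ‖R y‖ → dist z x₀ < ρ' := by
    intro z hz
    rw [dist_eq_norm]
    have := norm_sub_le_norm_sub_add_norm_sub z y x₀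
    nlinarith
  -- The `j`-th move is at most `2 * (1/2) ^ j * ‖R y‖`; the bound is the partial geometric sum.
  have main : ∀ m : ℕ, ‖T^[m] y - y‖ ≤ 4 * ‖R y‖ * (1 - (1 / 2) ^ m) ∧
      ‖R (T^[m] y)‖ ≤ (1 / 2) ^ m * ‖R y‖ := by
    intro m
    induction m with
    | zero => simp
    | succ m ih =>
      have hp : (0 : ℝ) < (1 / 2) ^ m := by positivity
      have hm : dist (T^[m] y) x₀ < ρ :=
        (near _ (ih.1.trans (by nlinarith [norm_nonneg (R y)]))).trans_le (min_le_left _ _)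
      obtain ⟨a, b⟩ := step _ hm
      rw [Function.iterate_succ_apply', pow_succ]
      constructor
      · have := norm_sub_le_norm_sub_add_norm_sub (T (T^[m] y)) (T^[m] y) y
        linarith [ih.1, ih.2]
      · linarith [ih.2]
  intro m
  have hp : (0 : ℝ) < (1 / 2) ^ m := by positivity
  exact (near _ ((main m).1.trans (by nlinarith [norm_nonneg (R y)]))).trans_le (min_le_right _ _)

/-! ### Strict differentiability of the flow map -/

theorem gronwallBound_zero_left_eq_mul (K ε x : ℝ) :
    gronwallBound 0 K ε x = ε * gronwallBound 0 K 1 x := by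
  unfold gronwallBound
  split_ifs <;> ring

/-- A `C¹` map is uniformly strictly differentiable at the points of a compact set. -/
theorem ContDiff.exists_forall_norm_sub_sub_fderiv_le {E F' : Type*} [NormedAddCommGroup E]
    [NormedSpace ℝ E] [NormedAddCommGroup F'] [NormedSpace ℝ F'] {F : E → F'} (hF : ContDiff ℝ 1 F)
    {s : Set E} (hs : IsCompact s) {ε : ℝ} (hε : 0 < ε) :
    ∃ ρ > 0, ∀ x ∈ s, ∀ y ∈ ball x ρ, ∀ z ∈ ball x ρ,
      ‖F y - F z - fderiv ℝ F x (y - z)‖ ≤ ε * ‖y - z‖ := by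
  have hc : Continuous (fderiv ℝ F) := hF.continuous_fderiv one_ne_zero
  have h := hs.uniformContinuousAt_of_continuousAt (fderiv ℝ F) (fun a _ => hc.continuousAt)
    (Metric.dist_mem_uniformity hε)
  obtain ⟨ρ, hρ, hρs⟩ := Metric.mem_uniformity_dist.1 h
  refine ⟨ρ, hρ, fun x hx y hy z hz => ?_⟩
  refine (convex_ball x ρ).norm_image_sub_le_of_norm_hasFDerivWithin_le'
    (f' := fderiv ℝ F) (fun w _ => (hF.differentiable one_ne_zero w).hasFDerivAt.hasFDerivWithinAt)
    (fun w hw => ?_) hz hy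
  have := hρs (show Dist.dist x w < ρ by rwa [dist_comm]) hx
  rw [← dist_eq_norm, dist_comm]
  exact le_of_lt this

/-- The time-`T` map of a flow is strictly differentiable at a point if the vector field is so,
uniformly along its orbit; its derivative is given by the variational equation. -/
theorem hasStrictFDerivAt_flow {E : Type*} [NormedAddCommGroup E] [NormedSpace ℝ E] {G : E → E}
    {K C : ℝ≥0} (hG : LipschitzWith K G) {φ : E → ℝ → E}
    (hφ : ∀ y, IsIntegralCurve (φ y) (fun _ => G)) (hφ0 : ∀ y, φ y 0 = y) (x₀ : E)
    {A : ℝ → E →L[ℝ] E} {T : ℝ} (hT : 0 ≤ T) (hA : ∀ t ∈ Icc 0 T, ‖A t‖ ≤ C)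
    (hGA : ∀ ε > 0, ∃ ρ > 0, ∀ t ∈ Icc 0 T, ∀ y ∈ ball (φ x₀ t) ρ, ∀ z ∈ ball (φ x₀ t) ρ,
      ‖G y - G z - A t (y - z)‖ ≤ ε * ‖y - z‖)
    {Φ : ℝ → E →L[ℝ] E} (hΦ : ∀ w t, HasDerivAt (fun s => Φ s w) (A t (Φ t w)) t)
    (hΦ0 : Φ 0 = ContinuousLinearMap.id ℝ E) :
    HasStrictFDerivAt (fun y => φ y T) (Φ T) x₀ := by
  refine .of_isLittleO (Asymptotics.isLittleO_iff.2 fun ε hε => ?_)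
  set B := gronwallBound 0 C 1 T with hB
  have hB0 : 0 ≤ B := by
    have := gronwallBound_mono le_rfl zero_le_one C.coe_nonneg hT
    rwa [gronwallBound_x0] at this
  set e := Real.exp (K * T) with he
  have he0 : 0 < e := Real.exp_pos _
  -- The factor `e` absorbs the spreading of trajectories up to time `T`, and `B + 1` the Grönwall
  -- factor `B`.
  obtain ⟨ρ, hρ, hρG⟩ := hGA (ε / (e * (B + 1))) (by positivity)
  have hmem : ball x₀ (ρ / e) ×ˢ ball x₀ (ρ / e) ∈ 𝓝 (x₀, x₀) :=
    prod_mem_nhds (ball_mem_nhds _ (by positivity)) (ball_mem_nhds _ (by positivity))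
  filter_upwards [hmem]
  rintro ⟨y, z⟩ ⟨hy, hz⟩
  have hnear : ∀ y ∈ ball x₀ (ρ / e), ∀ t ∈ Icc 0 T, φ y t ∈ ball (φ x₀ t) ρ := by
    intro y hy t ht
    have := (hφ y).dist_le_of_lipschitzWith hG (hφ x₀) ht.1 ht.2
    rw [hφ0, hφ0] at this
    exact this.trans_lt ((lt_div_iff₀ he0).1 hy)
  have hd : ∀ t ∈ Icc 0 T, ‖φ y t - φ z t‖ ≤ e * ‖y - z‖ := by
    intro t ht
    have := (hφ y).dist_le_of_lipschitzWith hG (hφ z) ht.1 ht.2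
    rwa [hφ0, hφ0, dist_eq_norm, dist_eq_norm, mul_comm] at this
  have hΦc : Continuous fun s => Φ s (y - z) :=
    continuous_iff_continuousAt.2 fun t => (hΦ (y - z) t).continuousAt
  -- The difference of two trajectories solves the variational equation up to a defect proportional
  -- to `‖y - z‖`.
  have := dist_le_of_approx_trajectories_ODE_of_mem (a := 0) (b := T) (K := C)
    (v := fun t => A t) (s := fun _ => univ) (f := fun t => φ y t - φ z t)
    (f' := fun t => G (φ y t) - G (φ z t)) (g := fun t => Φ t (y - z))
    (g' := fun t => A t (Φ t (y - z))) (εf := ε / (B + 1) * ‖y - z‖) (εg := 0) (δ := 0)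
    (fun t ht => ((A t).lipschitz.weaken (hA t (Ico_subset_Icc_self ht))).lipschitzOnWith)
    ((hφ y).continuous.sub (hφ z).continuous).continuousOn
    (fun t _ => ((hφ y t).sub (hφ z t)).hasDerivWithinAt)
    (fun t ht => by
      have ht' := Ico_subset_Icc_self ht
      rw [dist_eq_norm]
      refine (hρG t ht' _ (hnear y hy t ht') _ (hnear z hz t ht')).trans ?_
      calc ε / (e * (B + 1)) * ‖φ y t - φ z t‖ ≤ ε / (e * (B + 1)) * (e * ‖y - z‖) := by
            gcongr; exact hd t ht'
        _ = ε / (B + 1) * ‖y - z‖ := by field_simp)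
    (fun _ _ => trivial) hΦc.continuousOn (fun t _ => (hΦ _ t).hasDerivWithinAt)
    (fun t _ => by simp) (fun _ _ => trivial) (by simp [hφ0, hΦ0]) T (right_mem_Icc.2 hT)
  rw [gronwallBound_zero_left_eq_mul, dist_eq_norm, add_zero, sub_zero, ← hB] at this
  refine this.trans ?_
  calc ε / (B + 1) * ‖y - z‖ * B = ε * ‖y - z‖ * (B / (B + 1)) := by ring
    _ ≤ ε * ‖y - z‖ * 1 := by
      gcongr
      rw [div_le_one (by positivity)]
      linarith
    _ = _ := by simp

/-! ### From the monodromy matrix to Lyapunov stability -/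

namespace PatchModel

variable {ι : Type*} [Fintype ι] [DecidableEq ι]

/-- A square matrix as a continuous linear endomorphism. -/
noncomputable def mulVecCLM : Matrix ι ι ℝ →ₗ[ℝ] ((ι → ℝ) →L[ℝ] (ι → ℝ)) :=
  LinearMap.toContinuousLinearMap.toLinearMap ∘ₗ Matrix.toLin'.toLinearMap

@[simp]
theorem mulVecCLM_apply (A : Matrix ι ι ℝ) (w : ι → ℝ) : mulVecCLM A w = A.mulVec w := rfl

theorem mulVecCLM_pow (A : Matrix ι ι ℝ) (k : ℕ) : mulVecCLM A ^ k = mulVecCLM (A ^ k) := by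
  induction k with
  | zero => ext1 w; simp
  | succ k ih => ext1 w; simp [pow_succ, ih]

theorem jacobian_mulVec (F : (ι → ℝ) → ι → ℝ) (x w : ι → ℝ) :
    (jacobian F x).mulVec w = fderiv ℝ F x w := by
  have : jacobian F x = LinearMap.toMatrix' (fderiv ℝ F x).toLinearMap := by
    ext i j
    simp [jacobian, LinearMap.toMatrix'_apply]
  rw [this, LinearMap.toMatrix'_mulVec]
  rfl

theorem IsPrincipalFundamentalMatrix.hasDerivAt_mulVec {A Φ : ℝ → Matrix ι ι ℝ}
    (hΦ : IsPrincipalFundamentalMatrix A Φ) (w : ι → ℝ) (t : ℝ) :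
    HasDerivAt (fun s => (Φ s).mulVec w) ((A t).mulVec ((Φ t).mulVec w)) t := by
  rw [hasDerivAt_pi]
  intro i
  rw [Matrix.mulVec_mulVec]
  exact HasDerivAt.fun_sum fun j _ => (hΦ.2 t i j).mul_const (w j)

/-- A periodic orbit of a `C¹` vector field is Lyapunov stable if the powers of its monodromy matrix
converge to a matrix that vanishes on a complement of the direction of the flow. -/
theorem isLyapunovStable_of_tendsto_monodromy_pow {F : (ι → ℝ) → ι → ℝ} (hF : ContDiff ℝ 1 F)
    {ψ : ℝ → ι → ℝ} {p : ℝ} (hp : 0 < p) (hψ : IsIntegralCurve ψ (fun _ => F))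
    (hper : Function.Periodic ψ p) {Φ : ℝ → Matrix ι ι ℝ}
    (hΦ : IsPrincipalFundamentalMatrix (fun t => jacobian F (ψ t)) Φ) {P : Matrix ι ι ℝ}
    (hP : Tendsto (fun k : ℕ => Φ p ^ k) atTop (𝓝 P)) (q : (ι → ℝ) →L[ℝ] ℝ)
    (hq : q (F (ψ 0)) = 1) (hPq : ∀ w, q w = 0 → P.mulVec w = 0) :
    IsLyapunovStable F ψ := by
  obtain ⟨R, hR⟩ : ∃ R, ∀ t, ‖ψ t‖ ≤ R := by
    obtain ⟨R, hR⟩ := (isCompact_Icc (a := 0) (b := p)).exists_bound_of_continuousOn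
      hψ.continuous.continuousOn
    refine ⟨R, fun t => ?_⟩
    obtain ⟨s, hs, hst⟩ := hper.exists_mem_Ico₀ hp t
    rw [hst]
    exact hR s (Ico_subset_Icc_self hs)
  have hR0 : 0 ≤ R := (norm_nonneg _).trans (hR 0)
  -- Radius `R + 1` makes `G` agree with `F` on the unit tube around the orbit.
  obtain ⟨G, K, L, hG, hGL, hGF⟩ := hF.exists_lipschitzWith_eqOn_closedBall
    (R := R + 1) (by positivity)
  have hin : ∀ t x, dist x (ψ t) < 1 → x ∈ closedBall (0 : ι → ℝ) (R + 1) := by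
    intro t x hx
    rw [dist_eq_norm] at hx
    rw [mem_closedBall_zero_iff]
    linarith [norm_le_norm_add_norm_sub' x (ψ t), hR t]
  have hψG : IsIntegralCurve ψ (fun _ => G) := fun t => by
    have : G (ψ t) = F (ψ t) := hGF (hin t _ (by simp))
    simpa only [this] using hψ t
  choose φ hφ0 hφ using fun y => hG.exists_isIntegralCurve hGL y
  have huniq : ∀ y : ℝ → ι → ℝ, IsIntegralCurve y (fun _ => G) → φ (y 0) = y := by
    intro y hy
    exact ODE_solution_unique_univ (v := fun _ => G) (s := fun _ => univ) (t₀ := 0)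
      (fun _ => hG.lipschitzOnWith) (fun t => ⟨hφ _ t, trivial⟩) (fun t => ⟨hy t, trivial⟩)
      (hφ0 _)
  have hshift : ∀ y s t, φ (φ y s) t = φ y (t + s) := by
    intro y s t
    have := huniq _ ((hφ y).comp_add s)
    simpa using congrFun this t
  have hφψ : ∀ s t, φ (ψ s) t = ψ (t + s) := by
    intro s t
    have := huniq _ (hψG.comp_add s)
    simpa using congrFun this t
  set S : (ι → ℝ) → ι → ℝ := fun y => φ y p with hSdef
  have hfix : ∀ s, S (ψ s) = ψ s := fun s => by
    rw [hSdef]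
    simp only
    rw [hφψ, add_comm, hper]
  have hcpt : IsCompact (ψ '' Icc 0 p) := isCompact_Icc.image hψ.continuous
  have hS : HasStrictFDerivAt S (mulVecCLM (Φ p)) (ψ 0) := by
    have hφψ0 : φ (ψ 0) = ψ := huniq ψ hψG
    obtain ⟨C, hC⟩ := (isCompact_Icc (a := 0) (b := p)).exists_bound_of_continuousOn
      (f := fun t => fderiv ℝ F (ψ t))
      ((hF.continuous_fderiv one_ne_zero).comp hψ.continuous).continuousOn
    refine hasStrictFDerivAt_flow (C := C.toNNReal) (A := fun t => fderiv ℝ F (ψ t))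
      (Φ := fun t => mulVecCLM (Φ t)) hG hφ hφ0 (ψ 0) hp.le
      (fun t ht => (hC t ht).trans (Real.le_coe_toNNReal C)) (fun ε hε => ?_) (fun w t => ?_) ?_
    · rw [hφψ0]
      obtain ⟨ρ, hρ, h⟩ := hF.exists_forall_norm_sub_sub_fderiv_le hcpt hε
      refine ⟨min ρ 1, lt_min hρ one_pos, fun t ht y hy z hz => ?_⟩
      rw [mem_ball, lt_min_iff] at hy hz
      rw [hGF (hin t y hy.2), hGF (hin t z hz.2)]
      exact h _ (mem_image_of_mem _ ht) y hy.1 z hz.1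
    · have := hΦ.hasDerivAt_mulVec w t
      rwa [jacobian_mulVec] at this
    · ext1 w
      simp [hΦ.1]
  have hc : HasStrictDerivAt ψ (F (ψ 0)) 0 :=
    hasStrictDerivAt_of_hasDerivAt_of_continuousAt (.of_forall hψ)
      (hF.continuous.comp hψ.continuous).continuousAt
  have hM : Tendsto (fun k : ℕ => mulVecCLM (Φ p) ^ k) atTop (𝓝 (mulVecCLM P)) := by
    simp only [mulVecCLM_pow]
    exact (LinearMap.continuous_of_finiteDimensional mulVecCLM).continuousAt.tendsto.comp hP
  obtain ⟨k, hk, hstab⟩ := hS.exists_iterate_stable hc hfix q hq hM hPq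
  have hk' : (0 : ℝ) < k := by exact_mod_cast hk
  have hT0 : 0 < k * p := by positivity
  have hiter : ∀ m y, S^[m] y = φ y (m * p) := by
    intro m
    induction m with
    | zero => intro y; simp [hφ0]
    | succ m ih =>
      intro y
      rw [Function.iterate_succ_apply, ih, hSdef]
      simp only
      rw [hshift]
      push_cast
      ring_nf
  have hflow : ∀ ε > 0, ∃ η > 0, ∀ y, dist y (ψ 0) < η → ∀ t ≥ 0, dist (φ y t) (ψ t) < ε := by
    intro ε hε
    -- Dividing by the exponential pays for the growth since the last multiple of `k * p`.
    obtain ⟨η, hη, h⟩ := hstab (ε / Real.exp (K * (k * p))) (by positivity)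
    refine ⟨η, hη, fun y hy t ht => ?_⟩
    set m := ⌊t / (k * p)⌋₊ with hm
    have h1 : (m : ℝ) * (k * p) ≤ t := by
      rw [← le_div_iff₀ hT0]
      exact Nat.floor_le (by positivity)
    have h2 : t < (m + 1) * (k * p) := by
      rw [← div_lt_iff₀ hT0]
      exact Nat.lt_floor_add_one _
    have h3 := h y hy m
    rw [← Function.iterate_mul, hiter] at h3
    have h4 := (hφ (φ y ((k * m : ℕ) * p))).dist_le_of_lipschitzWith hG hψG
      (t := t - m * (k * p)) (T := k * p) (by linarith) (by linarith)
    rw [hφ0, hshift] at h4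
    have h5 : ψ (t - m * (k * p)) = ψ t := by
      have := hper.sub_nat_mul_eq (x := t) (m * k)
      rw [← this]
      push_cast
      ring_nf
    have h6 : t - m * (k * p) + (k * m : ℕ) * p = t := by
      push_cast
      ring
    rw [h5, h6] at h4
    exact h4.trans_lt ((lt_div_iff₀ (Real.exp_pos _)).1 h3)
  intro ε hε
  obtain ⟨η, hη, h⟩ := hflow (min ε 1) (lt_min hε one_pos)
  refine ⟨η, hη, fun y₀ hy₀ => ?_⟩
  have hmem : ∀ t ≥ 0, φ y₀ t ∈ closedBall (0 : ι → ℝ) (R + 1) := fun t ht =>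
    hin t _ ((h y₀ hy₀ t ht).trans_le (min_le_right _ _))
  have hsol : IsIntegralCurveOn (φ y₀) (fun _ => F) (Ici 0) := by
    intro t ht
    have := (hφ y₀ t).hasDerivWithinAt (s := Ici 0)
    simpa only [hGF (hmem t ht)] using this
  refine ⟨⟨φ y₀, hφ0 y₀, hsol⟩, fun y hy0 hy t ht => ?_⟩
  suffices hyφ : y t = φ y₀ t by
    rw [hyφ]
    exact (h y₀ hy₀ t ht).trans_le (min_le_left _ _)
  have hsub : Icc 0 t ⊆ Ici 0 := Icc_subset_Ici_self
  -- An arbitrary solution is not known to stay in the tube. On `[0, t]` both solutions lie in a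
  -- common ball, where `F` is Lipschitz and uniqueness applies.
  obtain ⟨R', hR'⟩ := (isCompact_Icc (a := 0) (b := t)).exists_bound_of_continuousOn
    (hy.continuousOn.mono hsub)
  set B := closedBall (0 : ι → ℝ) (max R' (R + 1)) with hB
  obtain ⟨K', hK'⟩ :=
    (hF.locallyLipschitz.locallyLipschitzOn (s := B)).exists_lipschitzOnWith_of_compact
      (isCompact_closedBall _ _)
  refine ODE_solution_unique_of_mem_Icc_right (v := fun _ => F) (s := fun _ => B) (K := K')
    (a := 0) (b := t) (fun _ _ => hK') (hy.continuousOn.mono hsub)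
    (fun s hs => (hy s hs.1).mono (Ici_subset_Ici.2 hs.1)) (fun s hs => ?_)
    (hsol.continuousOn.mono hsub)
    (fun s hs => (hsol s hs.1).mono (Ici_subset_Ici.2 hs.1)) (fun s hs => ?_)
    (hy0.trans (hφ0 y₀).symm) (right_mem_Icc.2 ht)
  · exact mem_closedBall_zero_iff.2 ((hR' s (Ico_subset_Icc_self hs)).trans (le_max_left _ _))
  · exact closedBall_subset_closedBall (le_max_right _ _) (hmem s hs.1)

end PatchModel

/-! ### Spectra of Kronecker products -/

namespace Matrix

variable {m ι : Type*} [Fintype m] [DecidableEq m] [Fintype ι] [DecidableEq ι]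

theorem charpoly_blockDiagonal {R : Type*} [CommRing R] (M : m → Matrix ι ι R) :
    (blockDiagonal M).charpoly = ∏ i, (M i).charpoly := by
  have : charmatrix (blockDiagonal M) = blockDiagonal fun i => charmatrix (M i) := by
    ext ⟨a, i⟩ ⟨b, j⟩
    by_cases hij : i = j
    · subst hij
      simp [charmatrix_apply, blockDiagonal_apply, diagonal_apply]
    · simp [blockDiagonal_apply, hij]
  simp only [charpoly, this, det_blockDiagonal]

theorem kronecker_pow {R : Type*} [CommSemiring R] (A : Matrix m m R) (B : Matrix ι ι R) (k : ℕ) :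
    (A ⊗ₖ B) ^ k = (A ^ k) ⊗ₖ (B ^ k) := by
  induction k with
  | zero => simp
  | succ k ih => rw [pow_succ, ih, ← mul_kronecker_mul, ← pow_succ, ← pow_succ]

/-- The characteristic polynomial of a Kronecker product whose first factor is symmetric. -/
theorem IsHermitian.charpoly_kronecker {W : Matrix m m ℝ} (hW : W.IsHermitian)
    (A : Matrix ι ι ℝ) : (W ⊗ₖ A).charpoly = ∏ i, (hW.eigenvalues i • A).charpoly := by
  have h : W ⊗ₖ A = (hW.eigenvectorUnitary : Matrix m m ℝ) ⊗ₖ (1 : Matrix ι ι ℝ) *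
      (diagonal hW.eigenvalues ⊗ₖ A) *
      (star (hW.eigenvectorUnitary : Matrix m m ℝ) ⊗ₖ (1 : Matrix ι ι ℝ)) := by
    conv_lhs => rw [hW.spectral_theorem, Unitary.conjStarAlgAut_apply]
    rw [← mul_kronecker_mul, ← mul_kronecker_mul, one_mul, mul_one]
    rfl
  rw [h, charpoly_mul_comm, ← mul_assoc, ← mul_kronecker_mul, Unitary.coe_star_mul_self, one_mul,
    one_kronecker_one, one_mul, diagonal_kronecker, charpoly_reindex, charpoly_blockDiagonal]

end Matrix

namespace PatchModel

open Matrix Polynomial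

/-! ### The averaging projection and its scalings -/

section Averaging

variable (n : ℕ)

/-- The projection of `ℝⁿ` onto the vectors with equal coordinates. -/
noncomputable def averaging : Matrix (Fin n) (Fin n) ℝ := Matrix.of fun _ _ => (n : ℝ)⁻¹

/-- The symmetric matrix with eigenvalue `1` on the vectors with equal coordinates and `c` on those
with coordinate sum zero. -/
noncomputable def averagingScale (c : ℝ) : Matrix (Fin n) (Fin n) ℝ :=
  averaging n + c • (1 - averaging n)

variable {n}

theorem averaging_mul_self (hn : n ≠ 0) : averaging n * averaging n = averaging n := by
  ext i j
  have : (n : ℝ) ≠ 0 := by exact_mod_cast hn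
  simp [averaging, Matrix.mul_apply, this]

theorem averagingScale_mul (hn : n ≠ 0) (c d : ℝ) :
    averagingScale n c * averagingScale n d = averagingScale n (c * d) := by
  have h := averaging_mul_self hn
  simp only [averagingScale, add_mul, mul_add, smul_mul_assoc, mul_smul_comm, sub_mul, mul_sub, h,
    one_mul, mul_one, sub_self, smul_zero, add_zero]
  module

theorem averagingScale_one : averagingScale n 1 = 1 := by
  simp [averagingScale]

theorem averagingScale_pow (hn : n ≠ 0) (c : ℝ) (k : ℕ) :
    averagingScale n c ^ k = averagingScale n (c ^ k) := by
  induction k with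
  | zero => simp [averagingScale_one]
  | succ k ih => rw [pow_succ, ih, averagingScale_mul hn, pow_succ]

theorem isHermitian_averagingScale (c : ℝ) : (averagingScale n c).IsHermitian := by
  ext i j
  by_cases h : i = j
  · subst h; simp [averagingScale, averaging]
  · simp [averagingScale, averaging, h, Ne.symm h]

theorem trace_averagingScale (hn : n ≠ 0) (c : ℝ) :
    (averagingScale n c).trace = 1 + c * (n - 1) := by
  have : (n : ℝ) ≠ 0 := by exact_mod_cast hn
  simp [averagingScale, averaging, Matrix.trace, this]
  field_simp

/-- The relation `(W - 1)(W - c) = 0` leaves only `1` and `c` as eigenvalues, and the trace `1 + c *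
(n - 1)` fixes the multiplicities. -/
theorem eigenvalues_averagingScale (hn : n ≠ 0) {c : ℝ} (hc : c ≠ 1) :
    ∃ i₀, (isHermitian_averagingScale (n := n) c).eigenvalues i₀ = 1 ∧
      ∀ i, i ≠ i₀ → (isHermitian_averagingScale (n := n) c).eigenvalues i = c := by
  set hW := isHermitian_averagingScale (n := n) c
  have hsq : averagingScale n c * averagingScale n c
      = (1 + c) • averagingScale n c - c • (1 : Matrix (Fin n) (Fin n) ℝ) := by
    rw [averagingScale_mul hn]
    ext i j
    simp [averagingScale]
    ring
  have hor : ∀ i, hW.eigenvalues i = 1 ∨ hW.eigenvalues i = c := by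
    intro i
    have hb := hW.mulVec_eigenvectorBasis i
    have hne : (hW.eigenvectorBasis i).ofLp ≠ 0 := by
      intro h0
      exact hW.eigenvectorBasis.orthonormal.ne_zero i (by ext j; simpa using congrFun h0 j)
    obtain ⟨j, hj⟩ := Function.ne_iff.1 hne
    have h2 := congrArg (fun M => (M.mulVec (hW.eigenvectorBasis i).ofLp) j) hsq
    simp only [← Matrix.mulVec_mulVec, Matrix.sub_mulVec, Matrix.smul_mulVec, Matrix.one_mulVec, hb,
      Matrix.mulVec_smul, Pi.smul_apply, Pi.sub_apply, smul_eq_mul] at h2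
    have h3 : (hW.eigenvalues i - 1) * (hW.eigenvalues i - c) = 0 := by
      apply mul_right_cancel₀ hj
      simp only [Pi.zero_apply] at *
      linear_combination h2
    rcases mul_eq_zero.1 h3 with h | h
    · exact .inl (sub_eq_zero.1 h)
    · exact .inr (sub_eq_zero.1 h)
  -- Each summand is `1` or `0` according as the eigenvalue is `1` or `c`, so the sum counts the
  -- eigenvalue `1`.
  have hsum : ∑ i, (hW.eigenvalues i - c) / (1 - c) = 1 := by
    have ht := hW.trace_eq_sum_eigenvalues
    rw [trace_averagingScale hn] at ht
    simp only [RCLike.ofReal_real_eq_id, id] at ht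
    rw [← Finset.sum_div, Finset.sum_sub_distrib, ← ht, div_eq_one_iff_eq (sub_ne_zero.2 hc.symm)]
    simp
    ring
  have hterm : ∀ i, 0 ≤ (hW.eigenvalues i - c) / (1 - c) := by
    intro i
    rcases hor i with h | h
    · rw [h, div_self (sub_ne_zero.2 hc.symm)]; exact zero_le_one
    · simp [h]
  have hex : ∃ i₀, hW.eigenvalues i₀ = 1 := by
    by_contra! hcon
    rw [Finset.sum_eq_zero] at hsum
    · exact zero_ne_one hsum
    · intro i _
      simp [(hor i).resolve_left (hcon i)]
  obtain ⟨i₀, hi₀⟩ := hex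
  refine ⟨i₀, hi₀, fun i hi => (hor i).resolve_left fun h1 => ?_⟩
  have hpair := Finset.add_le_sum (fun j _ => hterm j) (Finset.mem_univ i) (Finset.mem_univ i₀) hi
  rw [hsum, h1, hi₀, div_self (sub_ne_zero.2 hc.symm)] at hpair
  norm_num at hpair

end Averaging

/-! ### Planar matrices with eigenvalues `1` and `γ` -/

section Planar

/-- A planar matrix with characteristic roots `1` and `γ`: trace and determinant. -/
theorem trace_det_of_roots {A : Matrix (Fin 2) (Fin 2) ℝ} {γ : ℝ}
    (h : (A.map Complex.ofReal).charpoly.roots = {(1 : ℂ), (γ : ℂ)}) :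
    A.trace = 1 + γ ∧ A.det = γ := by
  have ht := Matrix.trace_eq_sum_roots_charpoly (A.map Complex.ofReal)
  have hd := Matrix.det_eq_prod_roots_charpoly (A.map Complex.ofReal)
  have hd' : (A.map Complex.ofReal).det = (A.det : ℂ) := (RingHom.map_det Complex.ofRealHom A).symm
  have ht' : (A.map Complex.ofReal).trace = (A.trace : ℂ) := by simp [Matrix.trace]
  rw [h, ht'] at ht
  rw [h, hd'] at hd
  simp only [Multiset.insert_eq_cons, Multiset.sum_cons, Multiset.sum_singleton,
    Multiset.prod_cons, Multiset.prod_singleton, one_mul] at ht hd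
  exact ⟨by exact_mod_cast ht, by exact_mod_cast hd⟩

theorem roots_charpoly_smul {A : Matrix (Fin 2) (Fin 2) ℝ} {γ : ℝ} (ht : A.trace = 1 + γ)
    (hd : A.det = γ) (w : ℝ) :
    ((w • A).charpoly.map Complex.ofRealHom).roots = {(w : ℂ), ((w * γ : ℝ) : ℂ)} := by
  have : (w • A).charpoly.map Complex.ofRealHom
      = (X - C (w : ℂ)) * (X - C ((w * γ : ℝ) : ℂ)) := by
    rw [Matrix.charpoly_fin_two, Matrix.trace_smul, Matrix.det_smul, ht, hd]
    simp
    ring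
  rw [this, roots_mul (mul_ne_zero (X_sub_C_ne_zero _) (X_sub_C_ne_zero _)), roots_X_sub_C,
    roots_X_sub_C]
  rfl

/-- By Cayley–Hamilton, `E = (A - γ) / (1 - γ)` is the spectral projection for the eigenvalue `1`,
and `A ^ k = E + γ ^ k • (1 - E)`. As `det E = 0` and `E` fixes `v`, its range is the line through
`v`; `q` reads off the coefficient. -/
theorem exists_tendsto_pow_of_trace_det {A : Matrix (Fin 2) (Fin 2) ℝ} {γ : ℝ} (hγ0 : 0 < γ)
    (hγ1 : γ < 1) (ht : A.trace = 1 + γ) (hd : A.det = γ) {v : Fin 2 → ℝ} (hv : v ≠ 0)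
    (hAv : A.mulVec v = v) :
    ∃ (E : Matrix (Fin 2) (Fin 2) ℝ) (q : (Fin 2 → ℝ) →L[ℝ] ℝ),
      Tendsto (fun k : ℕ => A ^ k) atTop (𝓝 E) ∧ q v = 1 ∧ ∀ w, E.mulVec w = q w • v := by
  have h1γ : 1 - γ ≠ 0 := by linarith
  set E : Matrix (Fin 2) (Fin 2) ℝ := (1 - γ)⁻¹ • (A - γ • 1) with hE
  have hCH : A * A = (1 + γ) • A - γ • (1 : Matrix (Fin 2) (Fin 2) ℝ) := by
    rw [Matrix.trace_fin_two] at ht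
    rw [Matrix.det_fin_two] at hd
    ext i j
    fin_cases i <;> fin_cases j <;> simp [Matrix.mul_apply, Fin.sum_univ_two] <;> grind
  have hAE : A * E = E := by
    rw [hE, mul_smul_comm, mul_sub, hCH, mul_smul_comm, mul_one]
    congr 1
    module
  have hA : A = E + γ • (1 - E) := by
    have : A = (1 - γ) • E + γ • (1 : Matrix (Fin 2) (Fin 2) ℝ) := by
      rw [hE, smul_smul, mul_inv_cancel₀ h1γ]
      module
    rw [this, hE]
    module
  have hpow : ∀ k : ℕ, A ^ k = E + γ ^ k • (1 - E) := by
    intro k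
    induction k with
    | zero => simp
    | succ k ih =>
      have h1 : A * (1 - E) = γ • (1 - E) := by
        rw [mul_sub, mul_one, hAE]
        nth_rw 1 [hA]
        simp
      rw [pow_succ', ih, mul_add, hAE, mul_smul_comm, h1, smul_smul, pow_succ]
  have hEv : E.mulVec v = v := by
    rw [hE, Matrix.smul_mulVec, Matrix.sub_mulVec, hAv, Matrix.smul_mulVec, Matrix.one_mulVec]
    rw [show v - γ • v = (1 - γ) • v by module, smul_smul, inv_mul_cancel₀ h1γ, one_smul]
  have hdet : E 0 0 * E 1 1 = E 0 1 * E 1 0 := by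
    rw [Matrix.trace_fin_two] at ht
    rw [Matrix.det_fin_two] at hd
    simp [hE]
    field_simp
    linear_combination hd - γ * ht
  have hrank : ∀ w, E.mulVec w 0 * v 1 = E.mulVec w 1 * v 0 := by
    intro w
    have h0 := congrFun hEv 0
    have h1 := congrFun hEv 1
    simp only [Matrix.mulVec, dotProduct, Fin.sum_univ_two] at h0 h1 ⊢
    linear_combination (w 0 * v 1 - w 1 * v 0) * hdet - (E 0 0 * w 0 + E 0 1 * w 1) * h1 +
      (E 1 0 * w 0 + E 1 1 * w 1) * h0
  obtain ⟨i, hi⟩ := Function.ne_iff.1 hv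
  simp only [Pi.zero_apply] at hi
  refine ⟨E, (v i)⁻¹ • (ContinuousLinearMap.proj i ∘L mulVecCLM E), ?_, ?_, ?_⟩
  · simp only [hpow]
    have := (tendsto_pow_atTop_nhds_zero_of_lt_one hγ0.le hγ1).smul_const (1 - E)
    simpa using this.const_add E
  · simp [hEv, hi]
  · intro w
    ext j
    simp only [_root_.smul_apply, ContinuousLinearMap.comp_apply,
      ContinuousLinearMap.proj_apply, mulVecCLM_apply, Pi.smul_apply, smul_eq_mul]
    have := hrank w
    generalize E.mulVec w = x at this ⊢
    fin_cases i <;> fin_cases j <;> simp at hi ⊢ <;> field_simp <;> linarith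

end Planar

/-! ### The patch field and its linearization -/

section Field

variable {f g : ℝ → ℝ → ℝ}

theorem contDiff_kineticField (hf : ContDiff ℝ 1 (fun x : ℝ × ℝ => f x.1 x.2))
    (hg : ContDiff ℝ 1 (fun x : ℝ × ℝ => g x.1 x.2)) : ContDiff ℝ 1 (kineticField f g) := by
  have hpair : ContDiff ℝ 1 (fun x : Fin 2 → ℝ => (x 0, x 1)) := by fun_prop
  rw [contDiff_pi]
  intro i
  fin_cases i
  · exact hf.comp hpair
  · exact hg.comp hpair

variable {n : ℕ} {D : Matrix (Fin 2) (Fin 2) ℝ} {d₀ : ℝ}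

theorem patchField_apply (hD : D = d₀ • (1 : Matrix (Fin 2) (Fin 2) ℝ)) (δ : ℝ)
    (U : Fin n × Fin 2 → ℝ) (j : Fin n) (k : Fin 2) :
    patchField n δ D f g U (j, k) = δ * d₀ * ∑ i, (U (i, k) - U (j, k)) +
      kineticField f g (fun l => U (j, l)) k := by
  subst hD
  fin_cases k <;> simp [patchField, kineticField, ← Finset.mul_sum, mul_assoc]

theorem patchField_synchronous (hD : D = d₀ • (1 : Matrix (Fin 2) (Fin 2) ℝ)) (δ : ℝ)
    (ψ : ℝ → Fin 2 → ℝ) (t : ℝ) (jk : Fin n × Fin 2) :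
    patchField n δ D f g (synchronous n ψ t) jk = kineticField f g (ψ t) jk.2 := by
  obtain ⟨j, k⟩ := jk
  simp [patchField_apply hD, synchronous]

theorem contDiff_patchField (hF : ContDiff ℝ 1 (kineticField f g))
    (hD : D = d₀ • (1 : Matrix (Fin 2) (Fin 2) ℝ)) (δ : ℝ) :
    ContDiff ℝ 1 (patchField n δ D f g) := by
  rw [contDiff_pi]
  rintro ⟨j, k⟩
  simp only [patchField_apply hD]
  have h : ContDiff ℝ 1 fun U : Fin n × Fin 2 → ℝ => kineticField f g (fun l => U (j, l)) :=
    hF.comp (contDiff_pi.2 fun l => contDiff_apply ℝ ℝ (j, l))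
  have := contDiff_pi.1 h k
  fun_prop

/-- All-to-all coupling with equal rates sums to `n` times the mean minus the patch's own state,
whence the projection `1 - averaging n`. -/
theorem jacobian_patchField_synchronous (hn : n ≠ 0) (hF : ContDiff ℝ 1 (kineticField f g))
    (hD : D = d₀ • (1 : Matrix (Fin 2) (Fin 2) ℝ)) (δ : ℝ) (ψ : ℝ → Fin 2 → ℝ) (t : ℝ) :
    jacobian (patchField n δ D f g) (synchronous n ψ t) =
      (1 : Matrix (Fin n) (Fin n) ℝ) ⊗ₖ jacobian (kineticField f g) (ψ t) -
        (δ * d₀ * n) • ((1 - averaging n) ⊗ₖ (1 : Matrix (Fin 2) (Fin 2) ℝ)) := by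
  have hn' : (n : ℝ) ≠ 0 := by exact_mod_cast hn
  let pr (j : Fin n) (k : Fin 2) : (Fin n × Fin 2 → ℝ) →L[ℝ] ℝ := ContinuousLinearMap.proj (j, k)
  let blk (j : Fin n) : (Fin n × Fin 2 → ℝ) →L[ℝ] (Fin 2 → ℝ) :=
    ContinuousLinearMap.pi fun l => pr j l
  have hcoord : ∀ j k, HasFDerivAt (fun U => patchField n δ D f g U (j, k))
      ((δ * d₀) • ∑ i, (pr i k - pr j k) + ContinuousLinearMap.proj k ∘L
        (fderiv ℝ (kineticField f g) (ψ t) ∘L blk j)) (synchronous n ψ t) := by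
    intro j k
    simp only [patchField_apply hD]
    refine HasFDerivAt.add (HasFDerivAt.const_mul (HasFDerivAt.fun_sum fun i _ =>
      (pr i k).hasFDerivAt.sub (pr j k).hasFDerivAt) _) ?_
    have h1 : HasFDerivAt (kineticField f g) (fderiv ℝ (kineticField f g) (ψ t))
        (blk j (synchronous n ψ t)) :=
      (hF.differentiable one_ne_zero (ψ t)).hasFDerivAt
    exact (ContinuousLinearMap.proj (R := ℝ) (φ := fun _ : Fin 2 => ℝ) k).hasFDerivAt.comp _
      (h1.comp _ (blk j).hasFDerivAt)
  have hfd : HasFDerivAt (patchField n δ D f g) _ (synchronous n ψ t) :=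
    hasFDerivAt_pi.2 fun jk : Fin n × Fin 2 => hcoord jk.1 jk.2
  ext ⟨j, k⟩ ⟨i, l⟩
  have hblk : blk j (Pi.single (i, l) 1) = if j = i then Pi.single l 1 else 0 := by
    ext l'
    by_cases hji : j = i
    · subst hji
      simp [blk, pr, Pi.single_apply]
    · simp [blk, pr, hji]
  have hsum : ∑ i', (pr i' k (Pi.single (i, l) 1) - pr j k (Pi.single (i, l) 1))
      = -(n * ((1 - averaging n) j i * (1 : Matrix (Fin 2) (Fin 2) ℝ) k l)) := by
    by_cases hkl : k = l
    · subst hkl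
      by_cases hji : j = i
      · subst hji
        simp [pr, Pi.single_apply, averaging]
        field_simp
        ring
      · simp [pr, Pi.single_apply, averaging, hji, hn']
    · simp [pr, hkl]
  simp only [jacobian, hfd.fderiv, Matrix.of_apply, Matrix.sub_apply, Matrix.smul_apply,
    Matrix.kroneckerMap_apply, ContinuousLinearMap.pi_apply, _root_.add_apply, _root_.smul_apply,
    _root_.sum_apply, _root_.sub_apply, ContinuousLinearMap.comp_apply,
    ContinuousLinearMap.proj_apply, hblk, hsum, smul_eq_mul]
  by_cases hji : j = i
  · subst hji
    simp
    ring
  · simp [hji]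
    ring

/-- The linearization about a synchronous solution decouples into the kinetic linearization along
the synchronous directions and a uniformly damped copy of it transverse to them. -/
theorem isPrincipalFundamentalMatrix_patch (hn : n ≠ 0) (hF : ContDiff ℝ 1 (kineticField f g))
    (hD : D = d₀ • (1 : Matrix (Fin 2) (Fin 2) ℝ)) (δ : ℝ) {ψ : ℝ → Fin 2 → ℝ}
    {Φ : ℝ → Matrix (Fin 2) (Fin 2) ℝ}
    (hΦ : IsPrincipalFundamentalMatrix (fun t => jacobian (kineticField f g) (ψ t)) Φ) :
    IsPrincipalFundamentalMatrix
      (fun t => jacobian (patchField n δ D f g) (synchronous n ψ t))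
      (fun t => averagingScale n (Real.exp (-(δ * d₀ * n) * t)) ⊗ₖ Φ t) := by
  set κ := δ * d₀ * n
  refine ⟨by simp [averagingScale_one, hΦ.1], ?_⟩
  rintro t ⟨j, k⟩ ⟨i, l⟩
  have hQ : (1 - averaging n) * averagingScale n (Real.exp (-κ * t)) =
      Real.exp (-κ * t) • (1 - averaging n) := by
    simp only [averagingScale, sub_mul, mul_add, mul_smul_comm, mul_sub, one_mul, mul_one,
      averaging_mul_self hn]
    module
  simp only [jacobian_patchField_synchronous hn hF hD]
  rw [sub_mul, smul_mul_assoc, ← mul_kronecker_mul, ← mul_kronecker_mul, one_mul, one_mul, hQ]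
  have he : HasDerivAt (fun s => Real.exp (-κ * s)) (Real.exp (-κ * t) * (-κ)) t := by
    simpa using ((hasDerivAt_id t).const_mul (-κ)).exp
  have := ((he.mul_const ((1 - averaging n) j i)).const_add (averaging n j i)).mul (hΦ.2 t k l)
  convert! this using 1
  simp only [Matrix.sub_apply, Matrix.smul_apply, Matrix.kroneckerMap_apply, averagingScale,
    Matrix.add_apply, smul_eq_mul, κ]
  ring

theorem IsPeriodicSolution.synchronous (hn : n ≠ 0)
    (hD : D = d₀ • (1 : Matrix (Fin 2) (Fin 2) ℝ)) (δ : ℝ) {ψ : ℝ → Fin 2 → ℝ} {p : ℝ}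
    (hψ : IsPeriodicSolution (kineticField f g) ψ p) :
    IsPeriodicSolution (patchField n δ D f g) (PatchModel.synchronous n ψ) p where
  isSolution t := by
    rw [hasDerivAt_pi]
    intro jk
    simp only [patchField_synchronous hD]
    exact hasDerivAt_pi.1 (hψ.isSolution t) jk.2
  period_pos := hψ.period_pos
  periodic t := by
    funext jk
    simp [PatchModel.synchronous, hψ.periodic t]
  minimal q hq hqp h := hψ.minimal q hq hqp fun t => by
    funext k
    exact congrFun (h t) (⟨0, Nat.pos_of_ne_zero hn⟩, k)

end Field

/-! ### The velocity along a periodic orbit -/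

section Variational

variable {ι : Type*} [Fintype ι] [DecidableEq ι]

/-- The velocity of a solution solves the variational equation along it. -/
theorem fundamentalMatrix_mulVec_field {F : (ι → ℝ) → ι → ℝ} (hF : ContDiff ℝ 1 F)
    {ψ : ℝ → ι → ℝ} (hψ : IsIntegralCurve ψ (fun _ => F)) {Φ : ℝ → Matrix ι ι ℝ}
    (hΦ : IsPrincipalFundamentalMatrix (fun t => jacobian F (ψ t)) Φ) {t : ℝ} (ht : 0 ≤ t) :
    (Φ t).mulVec (F (ψ 0)) = F (ψ t) := by
  obtain ⟨C, hC⟩ := (isCompact_Icc (a := 0) (b := t)).exists_bound_of_continuousOn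
    (f := fun t => fderiv ℝ F (ψ t))
    ((hF.continuous_fderiv one_ne_zero).comp hψ.continuous).continuousOn
  have h1 : ∀ s, HasDerivAt (fun s => (Φ s).mulVec (F (ψ 0)))
      (fderiv ℝ F (ψ s) ((Φ s).mulVec (F (ψ 0)))) s := fun s => by
    have := hΦ.hasDerivAt_mulVec (F (ψ 0)) s
    rwa [jacobian_mulVec] at this
  have h2 : ∀ s, HasDerivAt (fun s => F (ψ s)) (fderiv ℝ F (ψ s) (F (ψ s))) s := fun s =>
    (hF.differentiable one_ne_zero (ψ s)).hasFDerivAt.comp_hasDerivAt s (hψ s)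
  exact ODE_solution_unique_of_mem_Icc_right (v := fun s x => fderiv ℝ F (ψ s) x)
    (s := fun _ => univ) (K := C.toNNReal) (a := 0) (b := t)
    (fun s hs => ((fderiv ℝ F (ψ s)).lipschitz.weaken
      (NNReal.coe_le_coe.1 ((hC s (Ico_subset_Icc_self hs)).trans
        (Real.le_coe_toNNReal C)))).lipschitzOnWith)
    (fun s _ => (h1 s).continuousAt.continuousWithinAt) (fun s _ => (h1 s).hasDerivWithinAt)
    (fun _ _ => trivial)
    (fun s _ => (h2 s).continuousAt.continuousWithinAt) (fun s _ => (h2 s).hasDerivWithinAt)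
    (fun _ _ => trivial) (by simp [hΦ.1]) (right_mem_Icc.2 ht)

/-- A zero velocity at time `0` is propagated by the variational equation, so `ψ` would be constant
and `p / 2` a smaller period. -/
theorem IsPeriodicSolution.field_ne_zero {F : (ι → ℝ) → ι → ℝ} (hF : ContDiff ℝ 1 F)
    {ψ : ℝ → ι → ℝ} {p : ℝ} (hψ : IsPeriodicSolution F ψ p) {Φ : ℝ → Matrix ι ι ℝ}
    (hΦ : IsPrincipalFundamentalMatrix (fun t => jacobian F (ψ t)) Φ) : F (ψ 0) ≠ 0 := by
  intro h0
  have hp := hψ.period_pos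
  have hz : ∀ t, F (ψ t) = 0 := by
    intro t
    obtain ⟨s, hs, hst⟩ := hψ.periodic.exists_mem_Ico₀ hp t
    rw [hst, ← fundamentalMatrix_mulVec_field hF hψ.isSolution hΦ hs.1, h0, Matrix.mulVec_zero]
  have hconst : ∀ s t, ψ s = ψ t :=
    is_const_of_deriv_eq_zero (fun t => (hψ.isSolution t).differentiableAt)
      fun t => (hψ.isSolution t).deriv.trans (hz t)
  exact hψ.minimal (p / 2) (by linarith) (by linarith) fun t => hconst _ _

end Variational

end PatchModel

/-! ### The patch model -/

open PatchModel Matrix in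
theorem proposition3p3 (f g : ℝ → ℝ → ℝ)
    (hf : ContDiff ℝ 1 (fun x : ℝ × ℝ => f x.1 x.2))
    (hg : ContDiff ℝ 1 (fun x : ℝ × ℝ => g x.1 x.2))
    (ψ : ℝ → Fin 2 → ℝ) (p : ℝ)
    (hψ : PatchModel.IsPeriodicSolution (PatchModel.kineticField f g) ψ p)
    (γ : ℝ) (hγ_pos : 0 < γ) (hγ_lt : γ < 1)
    (hFloquet : PatchModel.HasFloquetMultipliers (PatchModel.kineticField f g) ψ p
      {(1 : ℂ), (γ : ℂ)})
    (n : ℕ) (hn : 2 ≤ n)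
    (D : Matrix (Fin 2) (Fin 2) ℝ) (d₀ : ℝ) (hd₀ : 0 < d₀)
    (hD₁₁ : D 0 0 = d₀) (hD₂₂ : D 1 1 = d₀) (hD₁₂ : D 0 1 = 0) (hD₂₁ : D 1 0 = 0) :
    ∃ δ₀ > 0, ∀ δ : ℝ, 0 < δ → δ < δ₀ →
      PatchModel.IsPeriodicSolution (PatchModel.patchField n δ D f g)
        (PatchModel.synchronous n ψ) p ∧
      PatchModel.IsLyapunovStable (PatchModel.patchField n δ D f g)
        (PatchModel.synchronous n ψ) ∧
      ∃ m : Multiset ℂ,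
        PatchModel.HasFloquetMultipliers (PatchModel.patchField n δ D f g)
          (PatchModel.synchronous n ψ) p (1 ::ₘ m) ∧
        ∀ μ ∈ m, ‖μ‖ < 1 := by
  have hn0 : n ≠ 0 := by omega
  have hnR : (0 : ℝ) < n := by positivity
  have hp := hψ.period_pos
  have hD : D = d₀ • (1 : Matrix (Fin 2) (Fin 2) ℝ) := by
    ext i j
    fin_cases i <;> fin_cases j <;> simp [hD₁₁, hD₂₂, hD₁₂, hD₂₁]
  have hF := contDiff_kineticField hf hg
  obtain ⟨Φ, hΦ, hroots⟩ := hFloquet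
  obtain ⟨htr, hdet⟩ := trace_det_of_roots hroots
  -- The value `1` is arbitrary: the argument works for every `δ > 0`.
  refine ⟨1, one_pos, fun δ hδ _ => ?_⟩
  have hΨ := isPrincipalFundamentalMatrix_patch (n := n) hn0 hF hD δ hΦ
  have hsync := hψ.synchronous (n := n) hn0 hD δ
  set c := Real.exp (-(δ * d₀ * n) * p) with hc
  have hc0 : 0 < c := Real.exp_pos _
  have hc1 : c < 1 := Real.exp_lt_one_iff.2 (by
    have : 0 < δ * d₀ * n * p := by positivity
    linarith)
  refine ⟨hsync, ?_, ?_⟩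
  · have hv := hψ.field_ne_zero hF hΦ
    have hAv : (Φ p).mulVec (kineticField f g (ψ 0)) = kineticField f g (ψ 0) := by
      have h := fundamentalMatrix_mulVec_field hF hψ.isSolution hΦ hp.le
      have h0 := hψ.periodic 0
      rw [zero_add] at h0
      rwa [h0] at h
    obtain ⟨E, q, hE, hqv, hEq⟩ :=
      exists_tendsto_pow_of_trace_det hγ_pos hγ_lt htr hdet hv hAv
    let blk (j : Fin n) : (Fin n × Fin 2 → ℝ) →L[ℝ] (Fin 2 → ℝ) :=
      ContinuousLinearMap.pi fun l => ContinuousLinearMap.proj (j, l)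
    -- The transverse functional is the mean of `q` over the patches; the limit matrix sends `w` to
    -- that mean times the kinetic velocity, in every patch.
    refine isLyapunovStable_of_tendsto_monodromy_pow (contDiff_patchField hF hD δ) hp
      hsync.isSolution hsync.periodic hΨ (P := averaging n ⊗ₖ E) ?_
      ((n : ℝ)⁻¹ • ∑ j, q ∘L blk j) ?_ ?_
    · have hW : Tendsto (fun k : ℕ => averagingScale n (c ^ k)) atTop (𝓝 (averaging n)) := by
        have := (tendsto_pow_atTop_nhds_zero_of_lt_one hc0.le hc1).smul_const (1 - averaging n)
        simpa [averagingScale] using this.const_add (averaging n)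
      simp only [kronecker_pow, averagingScale_pow hn0, ← hc]
      refine tendsto_pi_nhds.2 fun jk => tendsto_pi_nhds.2 fun il => ?_
      simp only [Matrix.kroneckerMap_apply]
      exact ((tendsto_pi_nhds.1 (tendsto_pi_nhds.1 hW jk.1)) il.1).mul
        ((tendsto_pi_nhds.1 (tendsto_pi_nhds.1 hE jk.2)) il.2)
    · have hb : ∀ j, blk j (patchField n δ D f g (synchronous n ψ 0)) =
          kineticField f g (ψ 0) := fun j => by
        ext l
        simp [blk, patchField_synchronous hD]
      simp [hb, hqv, hn0]
    · intro w hw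
      have hw' : ∑ j, q (blk j w) = 0 := by
        simpa [hn0] using hw
      ext ⟨j, k⟩
      have h1 : ∀ i, ∑ l, E k l * w (i, l) = q (blk i w) * kineticField f g (ψ 0) k := by
        intro i
        simpa [Matrix.mulVec, dotProduct, blk] using congrFun (hEq (blk i w)) k
      calc ((averaging n ⊗ₖ E).mulVec w) (j, k)
          = ∑ i, (n : ℝ)⁻¹ * ∑ l, E k l * w (i, l) := by
            simp [Matrix.mulVec, dotProduct, Fintype.sum_prod_type, averaging, mul_add,
              mul_assoc]
        _ = 0 := by
            simp only [h1]
            rw [← Finset.mul_sum, ← Finset.sum_mul, hw']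
            simp
  · obtain ⟨i₀, hi₀, hi⟩ := eigenvalues_averagingScale hn0 hc1.ne
    -- The index `i₀` contributes `{1, γ}`, every other index `{c, c γ}`.
    refine ⟨(γ : ℂ) ::ₘ ((Finset.univ.erase i₀).val.bind fun _ => {(c : ℂ), ((c * γ : ℝ) : ℂ)}),
      ⟨_, hΨ, ?_⟩, ?_⟩
    · have hmap : ((averagingScale n c ⊗ₖ Φ p).map Complex.ofReal).charpoly =
          ∏ i, ((isHermitian_averagingScale (n := n) c).eigenvalues i • Φ p).charpoly.map
            Complex.ofRealHom := by
        rw [← Polynomial.map_prod, ← (isHermitian_averagingScale c).charpoly_kronecker]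
        exact Matrix.charpoly_map _ Complex.ofRealHom
      simp only [← hc]
      rw [hmap, Polynomial.roots_prod]
      · simp only [roots_charpoly_smul htr hdet]
        rw [← Finset.insert_erase (Finset.mem_univ i₀),
          Finset.insert_val_of_notMem (Finset.notMem_erase _ _), Multiset.cons_bind, hi₀]
        rw [Multiset.bind_congr (g := fun _ => {(c : ℂ), ((c * γ : ℝ) : ℂ)})]
        · simp
        · intro i hi'
          rw [hi i (Finset.mem_erase.1 (Finset.mem_def.2 hi')).1]
      · exact Finset.prod_ne_zero_iff.2 fun i _ =>
          ((Matrix.charpoly_monic _).map Complex.ofRealHom).ne_zero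
    · intro μ hμ
      have hcγ : c * γ < 1 := by nlinarith
      simp only [Multiset.mem_cons, Multiset.mem_bind, Multiset.insert_eq_cons,
        Multiset.mem_singleton] at hμ
      rcases hμ with rfl | ⟨i, -, rfl | rfl⟩
      · rwa [Complex.norm_real, Real.norm_of_nonneg hγ_pos.le]
      · rwa [Complex.norm_real, Real.norm_of_nonneg hc0.le]
      · rwa [Complex.norm_real, Real.norm_of_nonneg (by positivity)]
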